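/- Let $d\ge 2$, let $\mathbb T^d=\mathbb R^d/(2\pi\mathbb Z)^d$ be the flat torus with Laplacian $\Delta$, and let $dx$ be its volume measure normalized to total mass $1$. For a probability measure $\mu$ on $\mathbb T^d$ write $\hat\mu(n)=\int_{\mathbb T^d}e^{-in\cdot x}\,d\mu(x)$, $n\in\mathbb Z^d$, and let $\|\cdot\|$ be the Euclidean norm. Let $\mu$ be a probability measure on $\mathbb T^d$ for which there exist $\alpha\ge 0$ and $C>0$ such that $$|\hat\mu(n)|^2\le C\|n\|^{-\alpha}\qquad\text{for all } n\in\mathbb Z^d\setminus\{0\}.$$ Then for every $a\in\mathcal C^\infty(\mathbb T^d)$ (complex valued) there exists a constant $C_a>0$ (which may depend on $a$, $\mu$, $\alpha$, $C$ and $d$) such that for every orthonormal basis $(\psi_j)_{j\ge 1}$ of $L^2(\mathbb T^d,dx)$ consisting of smooth eigenfunctions, $-\Delta\psi_j=\lambda_j^2\psi_j$ with $\lambda_j\ge 0$, and for every $\lambda\ge 2$, the number $N(\lambda)=|\{j\ge 1:\lambda_j\le\lambda\}|$ is finite and $$\frac1{N(\lambda)}\sum_{j:\lambda_j\le\lambda}\left|\int_{\mathbb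 T^d}a|\psi_j|^2\,d\mu-\int_{\mathbb T^d}a\,d\mu\right|^2\le C_a(\log\lambda)^2\lambda^{\max(d-2-\alpha,-1)}.$$ -/

import Mathlib

open MeasureTheory
open scoped ContDiff

noncomputable section

instance fact_zero_lt_two_pi : Fact ((0 : ℝ) < 2 * Real.pi) := ⟨Real.two_pi_pos⟩

/-- The torus `ℝ^d / (2πℤ)^d`. -/
abbrev Torus (d : ℕ) : Type := Fin d → AddCircle (2 * Real.pi)

/-- The projection `ℝ^d → ℝ^d / (2πℤ)^d`. -/
def Torus.proj {d : ℕ} (x : EuclideanSpace ℝ (Fin d)) : Torus d :=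
  fun i => ((x i : ℝ) : AddCircle (2 * Real.pi))

/-- The normalized volume measure `dx` on the torus (total mass `1`). -/
def torusMeasure (d : ℕ) : Measure (Torus d) :=
  Measure.pi fun _ => AddCircle.haarAddCircle

/-- A function on the torus is smooth when its periodic lift to `ℝ^d` is smooth. -/
def SmoothOnTorus {d : ℕ} (f : Torus d → ℂ) : Prop :=
  ContDiff ℝ ∞ (f ∘ Torus.proj)

/-- The Euclidean norm of a lattice point. -/
def latticeNorm {d : ℕ} (n : Fin d → ℤ) : ℝ :=
  Real.sqrt (∑ i, (n i : ℝ) ^ 2)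

/-- The character `x ↦ exp (i n·x)` of the torus. -/
def torusChar {d : ℕ} (n : Fin d → ℤ) (x : Torus d) : ℂ :=
  ∏ i, fourier (n i) (x i)

/-- The Fourier coefficient `∫ exp (-i n·x) dμ(x)` of a measure on the torus. -/
def measureFourierCoeff {d : ℕ} (μ : Measure (Torus d)) (n : Fin d → ℤ) : ℂ :=
  ∫ x, torusChar (-n) x ∂μ

/-- `f` is a smooth solution of `-Δ f = ev ^ 2 * f` on the torus, where `Δ` is the
flat Laplacian, computed on the periodic lift to `ℝ^d`. -/
def IsToralEigenfunction {d : ℕ} (f : Torus d → ℂ) (ev : ℝ) : Prop :=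
  SmoothOnTorus f ∧
    ∀ x : EuclideanSpace ℝ (Fin d),
      -(Laplacian.laplacian (f ∘ Torus.proj) x) = ((ev ^ 2 : ℝ) : ℂ) * f (Torus.proj x)

/-- `ψ` is an orthonormal (Hilbert) basis of the complex space `L²(𝕋^d, dx)` made of
Laplace eigenfunctions, `-Δ ψ_j = (ev j)² ψ_j` with `ev j ≥ 0`. -/
structure IsLaplaceEigenbasis {d : ℕ} (ψ : ℕ → Torus d → ℂ) (ev : ℕ → ℝ) : Prop where
  nonneg : ∀ j, 0 ≤ ev j
  eigen : ∀ j, IsToralEigenfunction (ψ j) (ev j)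
  basis : ∃ b : HilbertBasis ℕ ℂ (Lp ℂ 2 (torusMeasure d)),
    ∀ j, (b j : Torus d → ℂ) =ᵐ[torusMeasure d] ψ j

/-- The spectral counting function `N(lam)`, the number of `j` with `ev j ≤ lam`. -/
def spectralCount (ev : ℕ → ℝ) (lam : ℝ) : ℕ :=
  Set.ncard {j | ev j ≤ lam}

end

/-!
Equidistribution of toral eigenfunctions against a measure with decaying Fourier coefficients.

Write `ψ_j` in terms of its Fourier coefficients `c_j(ξ)`. Since the Laplacian is symmetric, these
vanish unless `|ξ| = ev j`, so `ψ_j` is a trigonometric polynomial at every point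
(`IsLaplaceEigenbasis.eq_sum`), and the matrix element `∫ a |ψ_j|² dμ - ∫ a dμ` is the quadratic
form at `c_j` of the matrix with entries `ν(ξ - η)` for `ξ ≠ η`, `|ξ| = |η|`, where
`ν(k) = ∫ exp (i k·x) a dμ` (`IsLaplaceEigenbasis.matrixElement_eq`). The matrices
`c_j(ξ) conj (c_j(η))` are orthonormal for the Hilbert–Schmidt inner product, so Bessel's inequality
(`sum_sq_norm_quadraticForm_le`) bounds the sum over `ev j ≤ lam` by the sum of `|ν(k)|²` over
`0 < ‖k‖ ≤ 2 lam`, weighted by the number of `ξ` with `|ξ| ≤ lam` and `2 ξ·k = |k|²`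
(`sum_pairs_le`).

If `k = g k'` with `k'` primitive, this hyperplane contains `O(lam ^ (d - 1) / ‖k'‖)` such points
(`card_hyperplane_mul_le`), while `|ν(k)|² = O(‖k‖ ^ (-α))`, because `ν` is the convolution of the
Fourier coefficients of `μ` with the rapidly decaying ones of `a`
(`exists_norm_integral_torusChar_mul_le`). With `β = min α (d - 1)` in place of `α`, the sum is
`lam ^ (2 d - 2 - β)` up to the factor `∑ g ^ (1 - d) ‖k'‖ ^ (-d) = O(log² lam)`
(`sum_rpow_mul_card_hyperplane_le`). Finally `N(lam)` is the number of lattice points of length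
at most `lam`, by Parseval's identity in both bases (`IsLaplaceEigenbasis.spectralCount_eq`), and
hence at least a constant times `lam ^ d`.

The results on Fourier series are obtained from Mathlib's torus `ℝ^d / ℤ^d` by rescaling.
Derivatives are related to Fourier coefficients by differentiating the translation invariance of
the Haar measure, which avoids integration by parts.
-/

open scoped ComplexConjugate

/-! ### Characters of the torus -/

section TorusChar

variable {d : ℕ}

lemma continuous_torusChar (n : Fin d → ℤ) : Continuous (torusChar n) := by
  unfold torusChar
  fun_prop

lemma torusChar_neg (n : Fin d → ℤ) (x : Torus d) : torusChar (-n) x = conj (torusChar n x) := by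
  simp only [torusChar, Pi.neg_apply, fourier_neg, map_prod]

lemma torusChar_add (m n : Fin d → ℤ) (x : Torus d) :
    torusChar (m + n) x = torusChar m x * torusChar n x := by
  simp only [torusChar, Pi.add_apply, fourier_add, Finset.prod_mul_distrib]

lemma torusChar_zero (x : Torus d) : torusChar (0 : Fin d → ℤ) x = 1 := by
  simp [torusChar]

lemma norm_torusChar (n : Fin d → ℤ) (x : Torus d) : ‖torusChar n x‖ = 1 := by
  rw [torusChar, norm_prod]
  exact Finset.prod_eq_one fun i _ => Circle.norm_coe _

lemma torusChar_add_apply (n : Fin d → ℤ) (x y : Torus d) :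
    torusChar n (x + y) = torusChar n x * torusChar n y := by
  simp only [torusChar, Pi.add_apply, fourier_apply, smul_add, AddCircle.toCircle_add,
    Circle.coe_mul, Finset.prod_mul_distrib]

lemma torusChar_proj_single (n : Fin d → ℤ) (i : Fin d) (t : ℝ) :
    torusChar n (Torus.proj (t • EuclideanSpace.single i (1 : ℝ))) =
      Complex.exp ((n i : ℂ) * Complex.I * t) := by
  rw [torusChar, Finset.prod_eq_single i]
  · simp only [Torus.proj, PiLp.smul_apply, PiLp.single_apply, if_true, smul_eq_mul,
      mul_one, fourier_coe_apply]
    congr 1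
    push_cast
    have : (Real.pi : ℂ) ≠ 0 := by exact_mod_cast Real.pi_ne_zero
    field_simp
  · intro j _ hj
    simp [Torus.proj, hj]
  · simp

end TorusChar

/-! ### Fourier series on the torus -/

section TorusMeasure

variable {d : ℕ}

instance : IsProbabilityMeasure (torusMeasure d) := by
  unfold torusMeasure; infer_instance

instance : (torusMeasure d).IsAddHaarMeasure := by
  unfold torusMeasure; infer_instance

lemma Torus.proj_add (x y : EuclideanSpace ℝ (Fin d)) :
    Torus.proj (x + y) = Torus.proj x + Torus.proj y := by
  ext i; simp [Torus.proj]

lemma Torus.isOpenQuotientMap_proj : IsOpenQuotientMap (Torus.proj (d := d)) := by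
  have h : IsOpenQuotientMap (fun (x : Fin d → ℝ) (i : Fin d) =>
      (x i : AddCircle (2 * Real.pi))) :=
    IsOpenQuotientMap.piMap fun _ => QuotientAddGroup.isOpenQuotientMap_mk
  exact h.comp (PiLp.homeomorph 2 fun _ : Fin d => ℝ).isOpenQuotientMap

lemma Torus.proj_surjective : Function.Surjective (Torus.proj (d := d)) :=
  Torus.isOpenQuotientMap_proj.surjective

lemma SmoothOnTorus.continuous {f : Torus d → ℂ} (hf : SmoothOnTorus f) : Continuous f :=
  (Torus.isOpenQuotientMap_proj.isQuotientMap.continuous_iff).2 (ContDiff.continuous hf)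

lemma Continuous.exists_norm_le_torus {f : Torus d → ℂ} (hf : Continuous f) :
    ∃ B, 0 ≤ B ∧ ∀ x, ‖f x‖ ≤ B := by
  obtain ⟨B, hB⟩ := isCompact_univ.exists_bound_of_continuousOn hf.continuousOn
  exact ⟨max B 0, le_max_right _ _, fun x => (hB x trivial).trans (le_max_left _ _)⟩

lemma Continuous.integrable_torus {f : Torus d → ℂ} (hf : Continuous f) (μ : Measure (Torus d))
    [IsFiniteMeasure μ] : Integrable f μ := by
  obtain ⟨B, -, hB⟩ := hf.exists_norm_le_torus
  exact Integrable.of_bound hf.aestronglyMeasurable B (ae_of_all _ hB)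

/-- The Fourier coefficient `∫ exp (-i n·x) f(x) dx` of a function on the torus. -/
noncomputable def torusCoeff (f : Torus d → ℂ) (n : Fin d → ℤ) : ℂ :=
  ∫ x, torusChar (-n) x * f x ∂torusMeasure d

lemma norm_torusCoeff_le {f : Torus d → ℂ} {B : ℝ} (hB : ∀ x, ‖f x‖ ≤ B) (n : Fin d → ℤ) :
    ‖torusCoeff f n‖ ≤ B := by
  have := norm_integral_le_of_norm_le_const (μ := torusMeasure d) (C := B)
    (ae_of_all _ fun x => show ‖torusChar (-n) x * f x‖ ≤ B by
      rw [norm_mul, norm_torusChar, one_mul]; exact hB x)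
  simpa [torusCoeff] using this

/-- The Fourier series of a continuous function with summable Fourier coefficients converges
pointwise to it. This is Mathlib's theorem on `ℝ^d / ℤ^d`, rescaled. -/
theorem hasSum_torusCoeff {f : Torus d → ℂ} (hf : Continuous f) (hs : Summable (torusCoeff f))
    (x : Torus d) : HasSum (fun n => torusCoeff f n * torusChar n x) (f x) := by
  have h1 : (1 : ℝ) ≠ 0 := one_ne_zero
  have h2 : 2 * Real.pi ≠ 0 := Real.two_pi_pos.ne'
  let e : AddCircle (1 : ℝ) ≃ₜ AddCircle (2 * Real.pi) := AddCircle.homeomorphAddCircle _ _ h1 h2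
  let Φ : UnitAddTorus (Fin d) → Torus d := fun y i => e (y i)
  have hΦ : Continuous Φ := continuous_pi fun i => e.continuous.comp (continuous_apply i)
  have he : MeasurePreserving e AddCircle.haarAddCircle AddCircle.haarAddCircle :=
    AddMonoidHom.measurePreserving
      (f := (AddCircle.equivAddCircle (1 : ℝ) (2 * Real.pi) h1 h2).toAddMonoidHom)
      e.continuous e.surjective (by simp)
  have hmp : MeasurePreserving Φ (Measure.pi fun _ => AddCircle.haarAddCircle) (torusMeasure d) :=
    measurePreserving_pi _ _ fun _ => he
  have hchar1 : ∀ (m : ℤ) (y : AddCircle (1 : ℝ)), fourier m (e y) = fourier m y := by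
    intro m y
    induction y using QuotientAddGroup.induction_on with
    | H y =>
      have : e (y : AddCircle (1 : ℝ)) = ((y * (1⁻¹ * (2 * Real.pi)) : ℝ) : AddCircle _) :=
        AddCircle.homeomorphAddCircle_apply_mk _ _ h1 h2 y
      erw [this]
      rw [fourier_coe_apply]
      erw [fourier_coe_apply]
      congr 1
      have : (Real.pi : ℂ) ≠ 0 := by exact_mod_cast Real.pi_ne_zero
      push_cast
      field_simp
  have hchar : ∀ (n : Fin d → ℤ) y, torusChar n (Φ y) = UnitAddTorus.mFourier n y := by
    intro n y
    simp only [torusChar, UnitAddTorus.mFourier, ContinuousMap.coe_mk, Φ, hchar1]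
  let F : C(UnitAddTorus (Fin d), ℂ) := ⟨f ∘ Φ, hf.comp hΦ⟩
  have hcoeff : ∀ n, UnitAddTorus.mFourierCoeff F n = torusCoeff f n := by
    intro n
    have hc : Continuous fun x => torusChar (-n) x * f x := (continuous_torusChar _).mul hf
    rw [torusCoeff, ← hmp.map_eq, integral_map hΦ.aemeasurable hc.aestronglyMeasurable]
    simp only [hchar]
    rfl
  have hs' : Summable (UnitAddTorus.mFourierCoeff F) := by
    convert hs using 1
    exact funext hcoeff
  let y : UnitAddTorus (Fin d) := fun i => e.symm (x i)
  have hy : Φ y = x := by ext i; simp [Φ, y]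
  have := UnitAddTorus.hasSum_mFourier_series_apply_of_summable hs' y
  simp only [hcoeff, ← hchar, hy, smul_eq_mul] at this
  convert this using 1
  simp [F, hy]

end TorusMeasure

/-! ### Differentiation and decay of Fourier coefficients -/

section Smooth

variable {d : ℕ}

/-- The partial derivative of a smooth function on the torus, with its effect on Fourier
coefficients. The latter is the derivative at `t = 0` of the identity
`∫ exp (-i n·x) f(x + t e_i) dx = exp (i n_i t) ∫ exp (-i n·x) f(x) dx`. -/
lemma SmoothOnTorus.exists_partialDeriv {f : Torus d → ℂ} (hf : SmoothOnTorus f) (i : Fin d) :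
    ∃ g : Torus d → ℂ, SmoothOnTorus g ∧
      (∀ x, g (Torus.proj x) = fderiv ℝ (f ∘ Torus.proj) x (EuclideanSpace.single i 1)) ∧
      ∀ n, torusCoeff g n = (n i : ℂ) * Complex.I * torusCoeff f n := by
  set v : EuclideanSpace ℝ (Fin d) := EuclideanSpace.single i 1 with hv
  have hper : ∀ x y : EuclideanSpace ℝ (Fin d), Torus.proj x = Torus.proj y →
      fderiv ℝ (f ∘ Torus.proj) x = fderiv ℝ (f ∘ Torus.proj) y := by
    intro x y hxy
    have : (fun z => (f ∘ Torus.proj) (z + (y - x))) = f ∘ Torus.proj := by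
      funext z
      have : Torus.proj (y - x) = 0 := by
        have h := Torus.proj_add (y - x) x
        rw [sub_add_cancel, hxy] at h
        simpa using h
      simp [Torus.proj_add, this]
    have h2 := fderiv_comp_add_right (𝕜 := ℝ) (f := f ∘ Torus.proj) (x := x) (y - x)
    rw [this] at h2
    rw [h2]; congr 1; abel
  let s := Function.surjInv (Torus.proj_surjective (d := d))
  have hs : ∀ y, Torus.proj (s y) = y := Function.surjInv_eq _
  let g : Torus d → ℂ := fun y => fderiv ℝ (f ∘ Torus.proj) (s y) v
  have hg : ∀ x, g (Torus.proj x) = fderiv ℝ (f ∘ Torus.proj) x v := fun x => by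
    simp only [g]; rw [hper _ x (hs _)]
  have hgs : SmoothOnTorus g := by
    have : g ∘ Torus.proj = fun x => fderiv ℝ (f ∘ Torus.proj) x v := funext hg
    unfold SmoothOnTorus
    rw [this]
    exact (ContDiff.fderiv_right hf (by simp)).clm_apply contDiff_const
  refine ⟨g, hgs, hg, fun n => ?_⟩
  have hfc := hf.continuous
  have hgc := hgs.continuous
  obtain ⟨B, -, hB⟩ := hgc.exists_norm_le_torus
  let F : ℝ → Torus d → ℂ := fun t x => torusChar (-n) x * f (x + Torus.proj (t • v))
  have hFc : ∀ t, Continuous (F t) := fun t =>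
    (continuous_torusChar _).mul (hfc.comp (continuous_id.add continuous_const))
  have hder : ∀ x t, HasDerivAt (fun t => F t x)
      (torusChar (-n) x * g (x + Torus.proj (t • v))) t := by
    intro x t
    obtain ⟨y, rfl⟩ := Torus.proj_surjective x
    refine HasDerivAt.const_mul _ ?_
    rw [← Torus.proj_add, hg]
    have h1 : HasFDerivAt (f ∘ Torus.proj) (fderiv ℝ (f ∘ Torus.proj) (y + t • v)) (y + t • v) :=
      ((ContDiff.differentiable hf (by simp)) _).hasFDerivAt
    have h2 : HasDerivAt (fun t : ℝ => y + t • v) v t := by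
      simpa using ((hasDerivAt_id t).smul_const v).const_add y
    have h3 := h1.comp_hasDerivAt t h2
    simpa [Function.comp_def, Torus.proj_add] using h3
  have key := (hasDerivAt_integral_of_dominated_loc_of_deriv_le (μ := torusMeasure d)
    (F := F) (F' := fun t x => torusChar (-n) x * g (x + Torus.proj (t • v))) (x₀ := (0 : ℝ))
    (bound := fun _ => B) (s := Set.univ) Filter.univ_mem
    (Filter.Eventually.of_forall fun t => (hFc t).aestronglyMeasurable)
    ((hFc 0).integrable_torus _)
    (Continuous.aestronglyMeasurable ((continuous_torusChar _).mul
      (hgc.comp (continuous_id.add continuous_const))))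
    (ae_of_all _ fun x t _ => by rw [norm_mul, norm_torusChar, one_mul]; exact hB _)
    (integrable_const _) (ae_of_all _ fun x t _ => hder x t)).2
  have hshift : (fun t => ∫ x, F t x ∂torusMeasure d) =
      fun t : ℝ => Complex.exp ((n i : ℂ) * Complex.I * t) * torusCoeff f n := by
    funext t
    rw [← torusChar_proj_single, torusCoeff, ← integral_const_mul,
      ← integral_add_right_eq_self (μ := torusMeasure d) (fun x => _ * (torusChar (-n) x * f x))
        (Torus.proj (t • v))]
    refine integral_congr_ae (ae_of_all _ fun x => ?_)
    have : torusChar n (Torus.proj (t • v)) * torusChar (-n) (Torus.proj (t • v)) = 1 := by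
      rw [← torusChar_add, add_neg_cancel, torusChar_zero]
    simp only [F, torusChar_add_apply, ← hv]
    linear_combination (-(torusChar (-n) x * f (x + Torus.proj (t • v)))) * this
  rw [hshift] at key
  have hexp : HasDerivAt (fun t : ℝ => Complex.exp ((n i : ℂ) * Complex.I * t) * torusCoeff f n)
      ((n i : ℂ) * Complex.I * torusCoeff f n) 0 := by
    have h0 : HasDerivAt (fun t : ℝ => (n i : ℂ) * Complex.I * (t : ℂ))
        ((n i : ℂ) * Complex.I * 1) 0 :=
      (HasDerivAt.ofReal_comp (hasDerivAt_id (0 : ℝ))).const_mul _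
    simpa using h0.cexp.mul_const (torusCoeff f n)
  have := key.unique hexp
  have hz : Torus.proj (0 : EuclideanSpace ℝ (Fin d)) = 0 := by ext j; simp [Torus.proj]
  simpa [torusCoeff, hz] using this

/-- The Laplacian of a smooth function on the torus, with its effect on Fourier coefficients. -/
lemma SmoothOnTorus.exists_laplacian {f : Torus d → ℂ} (hf : SmoothOnTorus f) :
    ∃ g : Torus d → ℂ, SmoothOnTorus g ∧
      (∀ x, g (Torus.proj x) = Laplacian.laplacian (f ∘ Torus.proj) x) ∧
      ∀ n, torusCoeff g n = -((∑ i, (n i) ^ 2 : ℤ) : ℂ) * torusCoeff f n := by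
  choose g₁ hs₁ hp₁ hc₁ using hf.exists_partialDeriv
  choose g hs hp hc using fun i => (hs₁ i).exists_partialDeriv i
  refine ⟨fun x => ∑ i, g i x, ?_, fun x => ?_, fun n => ?_⟩
  · exact ContDiff.sum fun i _ => hs i
  · rw [InnerProductSpace.laplacian_eq_iteratedFDeriv_orthonormalBasis _
      (EuclideanSpace.basisFun (Fin d) ℝ)]
    refine Finset.sum_congr rfl fun i _ => ?_
    have h1 : g₁ i ∘ Torus.proj =
        fun x => fderiv ℝ (f ∘ Torus.proj) x (EuclideanSpace.single i 1) := funext (hp₁ i)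
    have h2 : DifferentiableAt ℝ (fderiv ℝ (f ∘ Torus.proj)) x :=
      (ContDiff.fderiv_right (m := ∞) hf (by simp)).differentiable (by simp) x
    rw [hp, h1, iteratedFDeriv_two_apply, fderiv_clm_apply h2 (differentiableAt_const _)]
    simp
  · unfold torusCoeff
    simp only [Finset.mul_sum]
    rw [integral_finsetSum Finset.univ fun i _ => Continuous.integrable_torus
      (f := fun x => torusChar (-n) x * g i x) ((continuous_torusChar _).mul (hs i).continuous) _]
    push_cast
    rw [← Finset.sum_neg_distrib, Finset.sum_mul]
    refine Finset.sum_congr rfl fun i _ => ?_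
    have := hc i n
    rw [hc₁ i n] at this
    unfold torusCoeff at this
    rw [this]
    linear_combination ((n i : ℂ) ^ 2 * ∫ x, torusChar (-n) x * f x ∂torusMeasure d) *
      Complex.I_sq

lemma SmoothOnTorus.exists_iterate_laplacian {f : Torus d → ℂ} (hf : SmoothOnTorus f) (p : ℕ) :
    ∃ g : Torus d → ℂ, SmoothOnTorus g ∧
      ∀ n, torusCoeff g n = (-((∑ i, (n i) ^ 2 : ℤ) : ℂ)) ^ p * torusCoeff f n := by
  induction p with
  | zero => exact ⟨f, hf, by simp⟩
  | succ p ih =>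
    obtain ⟨g, hg, hc⟩ := ih
    obtain ⟨h, hh, -, hc'⟩ := hg.exists_laplacian
    exact ⟨h, hh, fun n => by rw [hc', hc]; ring⟩

lemma sq_norm_le_sum_sq (n : Fin d → ℤ) : ‖n‖ ^ 2 ≤ ((∑ i, (n i) ^ 2 : ℤ) : ℝ) := by
  have hS : (0 : ℝ) ≤ ((∑ i, (n i) ^ 2 : ℤ) : ℝ) := by
    exact_mod_cast Finset.sum_nonneg fun i _ => sq_nonneg (n i)
  rw [← Real.sqrt_le_sqrt_iff hS, Real.sqrt_sq (norm_nonneg _)]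
  refine (pi_norm_le_iff_of_nonneg (Real.sqrt_nonneg _)).2 fun i => Real.le_sqrt_of_sq_le ?_
  rw [Int.norm_eq_abs, sq_abs]
  exact_mod_cast Finset.single_le_sum (f := fun i => (n i) ^ 2) (fun i _ => sq_nonneg (n i))
    (Finset.mem_univ i)

/-- Fourier coefficients of a smooth function decay faster than any power. -/
lemma SmoothOnTorus.exists_decay {f : Torus d → ℂ} (hf : SmoothOnTorus f) (p : ℕ) :
    ∃ B, 0 ≤ B ∧ ∀ n, ‖torusCoeff f n‖ * (1 + ‖n‖) ^ (2 * p) ≤ B := by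
  obtain ⟨g, hg, hc⟩ := hf.exists_iterate_laplacian p
  obtain ⟨B₀, h0, hB₀⟩ := hf.continuous.exists_norm_le_torus
  obtain ⟨B₁, h1, hB₁⟩ := hg.continuous.exists_norm_le_torus
  refine ⟨2 ^ (2 * p - 1) * (B₀ + B₁), by positivity, fun n => ?_⟩
  have e0 := norm_torusCoeff_le hB₀ n
  have e1 := norm_torusCoeff_le hB₁ n
  rw [hc, norm_mul, norm_pow, norm_neg, Complex.norm_intCast] at e1
  have e2 : ‖n‖ ^ (2 * p) * ‖torusCoeff f n‖ ≤ B₁ := by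
    refine le_trans ?_ e1
    rw [pow_mul]
    gcongr
    exact (sq_norm_le_sum_sq n).trans (le_abs_self _)
  have e3 := add_pow_le zero_le_one (norm_nonneg n) (2 * p)
  calc ‖torusCoeff f n‖ * (1 + ‖n‖) ^ (2 * p)
      ≤ ‖torusCoeff f n‖ * (2 ^ (2 * p - 1) * (1 ^ (2 * p) + ‖n‖ ^ (2 * p))) := by gcongr
    _ = 2 ^ (2 * p - 1) * (‖torusCoeff f n‖ + ‖n‖ ^ (2 * p) * ‖torusCoeff f n‖) := by ring
    _ ≤ _ := by gcongr

lemma summable_one_add_norm_inv_pow :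
    Summable fun n : Fin d → ℤ => ((1 + ‖n‖) ^ (2 * d))⁻¹ := by
  have hs : Summable fun m : ℤ => ((1 + |(m : ℝ)|) ^ 2)⁻¹ := by
    refine Summable.of_nat_of_neg ?_ ?_ <;>
    · have := (summable_nat_add_iff 1).2 (Real.summable_nat_pow_inv (p := 2).2 (by norm_num))
      refine this.congr fun m => ?_
      push_cast
      simp [add_comm]
  refine summable_of_sum_le (c := ∏ _i : Fin d, ∑' m : ℤ, ((1 + |(m : ℝ)|) ^ 2)⁻¹)
    (fun n => by positivity) fun s => ?_
  let t : Fin d → Finset ℤ := fun i => s.image fun n => n i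
  calc ∑ n ∈ s, ((1 + ‖n‖) ^ (2 * d))⁻¹
      ≤ ∑ n ∈ s, ∏ i, ((1 + |(n i : ℝ)|) ^ 2)⁻¹ := by
        refine Finset.sum_le_sum fun n _ => ?_
        rw [Finset.prod_inv_distrib]
        refine inv_anti₀ (Finset.prod_pos fun i _ => by positivity) ?_
        calc ∏ i, (1 + |(n i : ℝ)|) ^ 2 ≤ ∏ _i : Fin d, (1 + ‖n‖) ^ 2 := by
              refine Finset.prod_le_prod (fun i _ => by positivity) fun i _ => ?_
              gcongr
              exact norm_le_pi_norm n i
          _ = (1 + ‖n‖) ^ (2 * d) := by simp [pow_mul]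
    _ ≤ ∑ n ∈ Fintype.piFinset t,
          ∏ i, ((1 + |(n i : ℝ)|) ^ 2)⁻¹ := by
        refine Finset.sum_le_sum_of_subset_of_nonneg (fun n hn => ?_)
          fun n _ _ => Finset.prod_nonneg fun i _ => by positivity
        exact Fintype.mem_piFinset.2 fun i => Finset.mem_image_of_mem _ hn
    _ = ∏ i : Fin d, ∑ m ∈ t i, ((1 + |(m : ℝ)|) ^ 2)⁻¹ :=
        (Finset.prod_univ_sum t fun _ m => ((1 + |(m : ℝ)|) ^ 2)⁻¹).symm
    _ ≤ _ := Finset.prod_le_prod (fun i _ => Finset.sum_nonneg fun m _ => by positivity)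
        fun i _ => hs.sum_le_tsum _ fun m _ => by positivity

lemma SmoothOnTorus.summable_torusCoeff_mul_pow {f : Torus d → ℂ} (hf : SmoothOnTorus f) (q : ℕ) :
    Summable fun n => ‖torusCoeff f n‖ * (1 + ‖n‖) ^ q := by
  obtain ⟨B, -, hB⟩ := hf.exists_decay (d + q)
  refine Summable.of_nonneg_of_le (fun n => by positivity) (fun n => ?_)
    (summable_one_add_norm_inv_pow.mul_left B)
  rw [← div_eq_mul_inv, le_div_iff₀ (by positivity)]
  refine le_trans ?_ (hB n)
  rw [mul_assoc, ← pow_add]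
  gcongr
  · linarith [norm_nonneg n]
  · omega

/-- The Fourier series of a smooth function converges pointwise. -/
lemma SmoothOnTorus.hasSum {f : Torus d → ℂ} (hf : SmoothOnTorus f) (x : Torus d) :
    HasSum (fun n => torusCoeff f n * torusChar n x) (f x) :=
  hasSum_torusCoeff hf.continuous
    (Summable.of_norm (by simpa using hf.summable_torusCoeff_mul_pow 0)) x

/-- The Laplacian is symmetric, so an eigenfunction with eigenvalue `ev ^ 2` has frequencies only
on the sphere `|n| = ev`. -/
lemma IsToralEigenfunction.torusCoeff_eq_zero {f : Torus d → ℂ} {ev : ℝ}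
    (hf : IsToralEigenfunction f ev) {n : Fin d → ℤ}
    (hn : ((∑ i, (n i) ^ 2 : ℤ) : ℝ) ≠ ev ^ 2) : torusCoeff f n = 0 := by
  obtain ⟨g, -, hp, hc⟩ := hf.1.exists_laplacian
  have hg : ∀ x, g x = -((ev ^ 2 : ℝ) : ℂ) * f x := by
    intro x
    obtain ⟨y, rfl⟩ := Torus.proj_surjective x
    rw [hp, neg_mul, ← hf.2 y, neg_neg]
  have h1 : torusCoeff g n = -((ev ^ 2 : ℝ) : ℂ) * torusCoeff f n := by
    rw [torusCoeff, torusCoeff, ← integral_const_mul]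
    refine integral_congr_ae (ae_of_all _ fun x => ?_)
    simp only [hg]; ring
  rw [hc] at h1
  have h2 : (((∑ i, (n i) ^ 2 : ℤ) : ℂ) - ((ev ^ 2 : ℝ) : ℂ)) * torusCoeff f n = 0 := by
    linear_combination -h1
  refine (mul_eq_zero.1 h2).resolve_left fun h => hn ?_
  exact_mod_cast sub_eq_zero.1 h

end Smooth

/-! ### Lattice points on hyperplanes -/

section Lattice

variable {d : ℕ}

/-- The lattice points of `ℤ^d` all of whose coordinates are at most `M` in absolute value. -/
noncomputable def latticeBox (d M : ℕ) : Finset (Fin d → ℤ) :=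
  Fintype.piFinset fun _ => Finset.Icc (-(M : ℤ)) M

lemma mem_latticeBox {M : ℕ} {k : Fin d → ℤ} : k ∈ latticeBox d M ↔ ∀ i, |k i| ≤ M := by
  simp [latticeBox, abs_le]

lemma card_latticeBox (d M : ℕ) : (latticeBox d M).card = (2 * M + 1) ^ d := by
  rw [latticeBox, Fintype.card_piFinset_const, Int.card_Icc]
  congr 1
  omega

lemma norm_eq_natCast_sup (k : Fin d → ℤ) :
    ‖k‖ = ((Finset.univ.sup fun i => (k i).natAbs : ℕ) : ℝ) := by
  have h : ∀ i, ‖k i‖ = ((k i).natAbs : ℝ) := fun i => by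
    rw [Int.norm_eq_abs, Nat.cast_natAbs, Int.cast_abs]
  refine le_antisymm ((pi_norm_le_iff_of_nonneg (Nat.cast_nonneg _)).2 fun i => ?_) ?_
  · rw [h]
    exact_mod_cast Finset.le_sup (f := fun i => (k i).natAbs) (Finset.mem_univ i)
  · rcases isEmpty_or_nonempty (Fin d) with hd | hd
    · simp
    · obtain ⟨i, -, hi⟩ := Finset.exists_mem_eq_sup Finset.univ Finset.univ_nonempty
        fun i => (k i).natAbs
      rw [hi, ← h]
      exact norm_le_pi_norm k i

lemma mem_latticeBox_iff_norm_le {M : ℕ} {k : Fin d → ℤ} : k ∈ latticeBox d M ↔ ‖k‖ ≤ M := by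
  rw [mem_latticeBox, pi_norm_le_iff_of_nonneg (Nat.cast_nonneg _)]
  refine forall_congr' fun i => ?_
  rw [Int.norm_eq_abs]
  exact_mod_cast Iff.rfl

lemma one_le_norm_of_ne_zero {k : Fin d → ℤ} (hk : k ≠ 0) : 1 ≤ ‖k‖ := by
  have := norm_pos_iff.2 hk
  rw [norm_eq_natCast_sup] at this ⊢
  exact_mod_cast this

/-- Every nonzero lattice point is a positive multiple of a primitive one, primitivity being
expressed by a Bézout relation. -/
lemma exists_primitive {k : Fin d → ℤ} (hk : k ≠ 0) :
    ∃ (g : ℕ) (k' u : Fin d → ℤ), 0 < g ∧ (∀ i, k i = g * k' i) ∧ ∑ i, u i * k' i = 1 := by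
  obtain ⟨g, hg⟩ := (IsPrincipalIdealRing.principal (Ideal.span (Set.range k))).principal
  change Ideal.span (Set.range k) = Ideal.span {g} at hg
  have hdvd : ∀ i, g ∣ k i := fun i => by
    rw [← Ideal.mem_span_singleton, ← hg]
    exact Ideal.subset_span ⟨i, rfl⟩
  obtain ⟨u, hu⟩ := (Ideal.mem_span_range_iff_exists_fun (x := g) (v := k)).1
    (by rw [hg]; exact Ideal.mem_span_singleton_self g)
  have hg0 : g ≠ 0 := by
    rintro rfl
    exact hk (funext fun i => zero_dvd_iff.1 (hdvd i))
  choose k' hk' using hdvd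
  have hu1 : ∑ i, u i * k' i = 1 := by
    refine mul_left_cancel₀ hg0 ?_
    rw [mul_one, Finset.mul_sum]
    refine Eq.trans (Finset.sum_congr rfl fun i _ => ?_) hu
    rw [hk']; ring
  have hpos : 0 < g.natAbs := Int.natAbs_pos.2 hg0
  rcases Int.natAbs_eq g with h | h
  · exact ⟨g.natAbs, k', u, hpos, fun i => by rw [← h, hk'], hu1⟩
  · refine ⟨g.natAbs, -k', -u, hpos, fun i => ?_, by simpa using hu1⟩
    rw [hk', Pi.neg_apply]
    linear_combination (k' i) * h

/-- A primitive linear form takes each small value at a small lattice point: reduce a Bézout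
solution modulo the largest coefficient, then correct the corresponding coordinate. -/
lemma exists_small_solution {k u : Fin d → ℤ} (hu : ∑ i, u i * k i = 1) {i₀ : Fin d}
    (hmax : ∀ i, |k i| ≤ |k i₀|) (h0 : k i₀ ≠ 0) {t : ℤ} (ht0 : 0 ≤ t) (ht : t < |k i₀|) :
    ∃ w : Fin d → ℤ, ∑ i, w i * k i = t ∧ ∀ i, |w i| ≤ (d + 1) * |k i₀| := by
  set K := |k i₀| with hK
  have hK0 : 0 < K := abs_pos.2 h0
  let r : Fin d → ℤ := fun i => (t * u i) % K
  have hr : ∀ i, |r i| ≤ K := fun i => by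
    rw [abs_of_nonneg (Int.emod_nonneg _ hK0.ne')]
    exact (Int.emod_lt_of_pos _ hK0).le
  have hdvd : k i₀ ∣ t - ∑ i ∈ Finset.univ.erase i₀, r i * k i := by
    have h1 : t = ∑ i, (t * u i) * k i := by
      simp_rw [mul_assoc]
      rw [← Finset.mul_sum, hu, mul_one]
    rw [← Finset.add_sum_erase _ _ (Finset.mem_univ i₀)] at h1
    have h2 : t - ∑ i ∈ Finset.univ.erase i₀, r i * k i =
        t * u i₀ * k i₀ + ∑ i ∈ Finset.univ.erase i₀, (t * u i - r i) * k i := by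
      simp_rw [sub_mul]
      rw [Finset.sum_sub_distrib]
      linarith
    rw [h2]
    refine dvd_add (dvd_mul_left _ _) (Finset.dvd_sum fun i _ => Dvd.dvd.mul_right ?_ _)
    exact (dvd_abs _ _ |>.2 dvd_rfl).trans (Int.dvd_self_sub_emod)
  obtain ⟨q, hq⟩ := hdvd
  refine ⟨Function.update r i₀ q, ?_, fun i => ?_⟩
  · rw [← Finset.add_sum_erase _ _ (Finset.mem_univ i₀), Function.update_self]
    have : ∑ i ∈ Finset.univ.erase i₀, Function.update r i₀ q i * k i =
        ∑ i ∈ Finset.univ.erase i₀, r i * k i := Finset.sum_congr rfl fun i hi => by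
      rw [Function.update_of_ne (Finset.ne_of_mem_erase hi)]
    rw [this]
    linarith
  · rcases eq_or_ne i i₀ with rfl | hi
    · rw [Function.update_self]
      refine le_of_mul_le_mul_left ?_ hK0
      have hS : |∑ j ∈ Finset.univ.erase i, r j * k j| ≤ d * (K * K) := by
        refine (Finset.abs_sum_le_sum_abs _ _).trans ?_
        refine (Finset.sum_le_sum fun j _ => show |r j * k j| ≤ K * K from ?_).trans ?_
        · rw [abs_mul]
          exact mul_le_mul (hr j) (hmax j) (abs_nonneg _) hK0.le
        · rw [Finset.sum_const, nsmul_eq_mul]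
          gcongr
          exact (Finset.card_erase_le).trans (by simp)
      calc K * |q| = |t - ∑ j ∈ Finset.univ.erase i, r j * k j| := by rw [hq, abs_mul]
        _ ≤ |t| + |∑ j ∈ Finset.univ.erase i, r j * k j| := abs_sub _ _
        _ ≤ K * K + d * (K * K) := by
            gcongr
            rw [abs_of_nonneg ht0]
            nlinarith
        _ = K * ((d + 1) * K) := by ring
    · rw [Function.update_of_ne hi]
      refine (hr i).trans ?_
      nlinarith

/-- Lattice points of a box on a hyperplane with primitive normal `k`. The translates of this set
by points where the linear form takes the `|k i₀| R` distinct values `t + s * k i₀`,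
`0 ≤ t < |k i₀|`, `0 ≤ s < R`, are pairwise disjoint and contained in a box of comparable size. -/
lemma card_hyperplane_mul_le {k u : Fin d → ℤ} (hu : ∑ i, u i * k i = 1) {i₀ : Fin d}
    (hmax : ∀ i, |k i| ≤ |k i₀|) (h0 : k i₀ ≠ 0) {R : ℕ} (hkR : |k i₀| ≤ 2 * R) (c : ℤ) :
    ((latticeBox d R).filter fun ξ => ∑ i, ξ i * k i = c).card * ((k i₀).natAbs * R) ≤
      ((4 * d + 9) * R) ^ d := by
  have hR : 1 ≤ R := by
    have := abs_pos.2 h0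
    omega
  have hcast : ((k i₀).natAbs : ℤ) = |k i₀| := Int.natCast_natAbs _
  have hex : ∀ t : ℕ, ∃ w : Fin d → ℤ, t < (k i₀).natAbs →
      ∑ i, w i * k i = t ∧ ∀ i, |w i| ≤ (d + 1) * |k i₀| := by
    intro t
    by_cases ht : t < (k i₀).natAbs
    · obtain ⟨w, hw⟩ := exists_small_solution hu hmax h0 (Int.natCast_nonneg t) (by omega)
      exact ⟨w, fun _ => hw⟩
    · exact ⟨0, fun h => absurd h ht⟩
  choose w hw using hex
  let φ : (Fin d → ℤ) × ℕ × ℕ → (Fin d → ℤ) := fun p =>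
    p.1 + w p.2.1 + Pi.single i₀ (p.2.2 : ℤ)
  have hval : ∀ p : (Fin d → ℤ) × ℕ × ℕ, p.2.1 < (k i₀).natAbs → ∑ i, p.1 i * k i = c →
      ∑ i, φ p i * k i = c + p.2.1 + p.2.2 * k i₀ := by
    intro p hp hc
    simp only [φ, Pi.add_apply, add_mul, Finset.sum_add_distrib, hc, (hw _ hp).1]
    congr 1
    rw [Finset.sum_eq_single i₀] <;> simp +contextual
  have hle := Finset.card_le_card_of_injOn (t := latticeBox d ((2 * d + 4) * R))
    (s := ((latticeBox d R).filter fun ξ => ∑ i, ξ i * k i = c) ×ˢ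
      (Finset.range (k i₀).natAbs ×ˢ Finset.range R)) φ ?_ ?_
  · rw [Finset.card_product, Finset.card_product, Finset.card_range, Finset.card_range,
      card_latticeBox] at hle
    refine hle.trans (Nat.pow_le_pow_left ?_ d)
    nlinarith
  · intro p hp
    simp only [Finset.coe_product, Set.mem_prod, Finset.mem_coe, Finset.mem_filter,
      Finset.mem_range, mem_latticeBox] at hp
    obtain ⟨⟨hξ, -⟩, ht, hs⟩ := hp
    refine mem_latticeBox.2 fun i => ?_
    have h1 := (hw _ ht).2 i
    have h2 : |(Pi.single i₀ (p.2.2 : ℤ) : Fin d → ℤ) i| ≤ R := by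
      rcases eq_or_ne i i₀ with rfl | hi
      · simp; omega
      · simp [hi]
    calc |φ p i| ≤ |p.1 i| + |w p.2.1 i| + |(Pi.single i₀ (p.2.2 : ℤ) : Fin d → ℤ) i| :=
          abs_add_three _ _ _
      _ ≤ R + (d + 1) * (2 * R) + R := by
          gcongr
          · exact hξ i
          · exact h1.trans (by gcongr)
      _ = _ := by push_cast; ring
  · intro p hp p' hp' heq
    simp only [Finset.coe_product, Set.mem_prod, Finset.mem_coe, Finset.mem_filter,
      Finset.mem_range] at hp hp'
    obtain ⟨⟨-, hc⟩, ht, hs⟩ := hp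
    obtain ⟨⟨-, hc'⟩, ht', hs'⟩ := hp'
    have e1 := hval p ht hc
    rw [heq, hval p' ht' hc'] at e1
    have hmod : ((p.2.1 : ℤ)) = p'.2.1 := by
      have hd : k i₀ ∣ (p.2.1 : ℤ) - p'.2.1 := ⟨p'.2.2 - p.2.2, by linarith⟩
      have := Int.eq_zero_of_abs_lt_dvd ((abs_dvd _ _).2 hd) (abs_lt.2 ⟨by omega, by omega⟩)
      linarith
    have hsR : ((p.2.2 : ℤ)) = p'.2.2 := by
      refine mul_right_cancel₀ h0 ?_
      linarith
    have h1 : p.2.1 = p'.2.1 := by exact_mod_cast hmod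
    have h2 : p.2.2 = p'.2.2 := by exact_mod_cast hsR
    have h3 : p.1 = p'.1 := by
      have : p.1 + w p.2.1 + Pi.single i₀ (p.2.2 : ℤ) =
        p'.1 + w p'.2.1 + Pi.single i₀ (p'.2.2 : ℤ) := heq
      rw [h1, h2] at this
      simpa using this
    exact Prod.ext h3 (Prod.ext h1 h2)

lemma card_norm_eq_le {m : ℕ} (hm : 1 ≤ m) :
    (((latticeBox d m).filter fun k => ‖k‖ = m).card : ℝ) ≤ 2 * d * (2 * m + 1) ^ (d - 1) := by
  have hsub : latticeBox d (m - 1) ⊆ latticeBox d m := fun k hk => by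
    rw [mem_latticeBox] at hk ⊢
    exact fun i => (hk i).trans (by omega)
  have hle : ((latticeBox d m).filter fun k => ‖k‖ = m) ⊆
      latticeBox d m \ latticeBox d (m - 1) := by
    intro k hk
    rw [Finset.mem_filter] at hk
    refine Finset.mem_sdiff.2 ⟨hk.1, fun h => ?_⟩
    rw [mem_latticeBox_iff_norm_le, hk.2] at h
    have : m ≤ m - 1 := by exact_mod_cast h
    omega
  have h1 := Finset.card_le_card hle
  rw [Finset.card_sdiff_of_subset hsub, card_latticeBox, card_latticeBox] at h1
  have h2 : (2 * (m - 1) + 1) ^ d ≤ (2 * m + 1) ^ d := Nat.pow_le_pow_left (by omega) d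
  have h3 : (((latticeBox d m).filter fun k => ‖k‖ = m).card : ℝ) ≤
      (2 * m + 1 : ℝ) ^ d - (2 * m - 1 : ℝ) ^ d := by
    have : (((latticeBox d m).filter fun k => ‖k‖ = m).card : ℝ) ≤
        (((2 * m + 1) ^ d - (2 * (m - 1) + 1) ^ d : ℕ) : ℝ) := by exact_mod_cast h1
    rw [Nat.cast_sub h2] at this
    push_cast [Nat.cast_sub hm] at this
    convert this using 3
    ring
  refine h3.trans ?_
  rcases Nat.eq_zero_or_pos d with rfl | hd
  · simp
  have hm' : (1 : ℝ) ≤ m := by exact_mod_cast hm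
  have ha : (0 : ℝ) < 2 * m + 1 := by positivity
  -- Bernoulli's inequality for `(1 - 2 / (2 m + 1)) ^ d`
  have hb : 1 + (d : ℝ) * (-(2 / (2 * m + 1))) ≤ (1 + -(2 / (2 * m + 1 : ℝ))) ^ d := by
    refine one_add_mul_le_pow ?_ d
    rw [neg_le_neg_iff, div_le_iff₀ ha]
    linarith
  have hmul := mul_le_mul_of_nonneg_right hb (pow_pos ha d).le
  rw [← mul_pow] at hmul
  have e1 : (1 + -(2 / (2 * m + 1 : ℝ))) * (2 * m + 1) = 2 * m - 1 := by field_simp; ring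
  have e2 : (1 + (d : ℝ) * (-(2 / (2 * m + 1)))) * (2 * m + 1) ^ d =
      (2 * m + 1) ^ d - 2 * d * (2 * m + 1) ^ (d - 1) := by
    obtain ⟨e, rfl⟩ := Nat.exists_eq_succ_of_ne_zero hd.ne'
    rw [Nat.succ_sub_one, pow_succ]
    field_simp
    ring
  rw [e1, e2] at hmul
  linarith

lemma sum_Icc_inv_le (M : ℕ) : ∑ m ∈ Finset.Icc 1 M, (m : ℝ)⁻¹ ≤ 1 + Real.log M := by
  have := harmonic_le_one_add_log M
  rw [harmonic_eq_sum_Icc] at this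
  push_cast at this
  exact this

lemma sum_norm_inv_pow_le (d M : ℕ) :
    ∑ k ∈ (latticeBox d M).erase 0, (‖k‖ ^ d)⁻¹ ≤ 2 * d * 3 ^ (d - 1) * (1 + Real.log M) := by
  have hmaps : ∀ k ∈ (latticeBox d M).erase 0,
      (Finset.univ.sup fun i => (k i).natAbs) ∈ Finset.Icc 1 M := by
    intro k hk
    rw [Finset.mem_erase, mem_latticeBox_iff_norm_le] at hk
    have h1 := one_le_norm_of_ne_zero hk.1
    rw [norm_eq_natCast_sup] at hk h1
    exact Finset.mem_Icc.2 ⟨by exact_mod_cast h1, by exact_mod_cast hk.2⟩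
  rw [← Finset.sum_fiberwise_of_maps_to hmaps]
  calc _ ≤ ∑ m ∈ Finset.Icc 1 M, 2 * d * 3 ^ (d - 1) * (m : ℝ)⁻¹ := by
        refine Finset.sum_le_sum fun m hm => ?_
        obtain ⟨hm1, -⟩ := Finset.mem_Icc.1 hm
        have hm0 : (1 : ℝ) ≤ m := by exact_mod_cast hm1
        have hn : ∀ k ∈ ((latticeBox d M).erase 0).filter
            (fun k => (Finset.univ.sup fun i => (k i).natAbs) = m), ‖k‖ = m := by
          intro k hk
          rw [norm_eq_natCast_sup, (Finset.mem_filter.1 hk).2]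
        rw [Finset.sum_congr rfl fun k hk => by rw [hn k hk], Finset.sum_const, nsmul_eq_mul]
        have hsub : ((latticeBox d M).erase 0).filter
            (fun k => (Finset.univ.sup fun i => (k i).natAbs) = m) ⊆
            (latticeBox d m).filter fun k => ‖k‖ = m := fun k hk =>
          Finset.mem_filter.2 ⟨mem_latticeBox_iff_norm_le.2 (hn k hk).le, hn k hk⟩
        have hc : ((((latticeBox d M).erase 0).filter
            (fun k => (Finset.univ.sup fun i => (k i).natAbs) = m)).card : ℝ) ≤
            2 * d * (2 * m + 1) ^ (d - 1) :=
          le_trans (by exact_mod_cast Finset.card_le_card hsub) (card_norm_eq_le hm1)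
        rcases Nat.eq_zero_or_pos d with rfl | hd
        · simpa using hc
        obtain ⟨e, rfl⟩ := Nat.exists_eq_succ_of_ne_zero hd.ne'
        rw [Nat.succ_sub_one] at hc ⊢
        calc _ ≤ 2 * ((e.succ : ℕ) : ℝ) * (3 * m) ^ e * ((m : ℝ) ^ e.succ)⁻¹ := by
              gcongr
              refine hc.trans ?_
              gcongr
              linarith
          _ = _ := by
              rw [mul_pow, pow_succ]
              field_simp
    _ ≤ _ := by
        rw [← Finset.mul_sum]
        gcongr
        exact sum_Icc_inv_le M

/-- Hyperplane counts weighted by a power of the length of the normal, summed over all normals.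
One factor `1 + log (2 R)` comes from the harmonic sum over the gcd of the normal, the other from
the one over the length of its primitive part. -/
lemma sum_rpow_mul_card_hyperplane_le (hd : 2 ≤ d) {R : ℕ} (hR : 1 ≤ R) {β : ℝ}
    (hβ : β ≤ d - 1) (c : (Fin d → ℤ) → ℤ) :
    ∑ k ∈ (latticeBox d (2 * R)).erase 0, ‖k‖ ^ (-β) *
        (((latticeBox d R).filter fun ξ => ∑ i, ξ i * k i = c k).card : ℝ) ≤
      (2 * R : ℝ) ^ ((d : ℝ) - 1 - β) * ((4 * d + 9) ^ d * (R : ℝ) ^ (d - 1)) *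
        (2 * d * 3 ^ (d - 1)) * (1 + Real.log (2 * R)) ^ 2 := by
  have hR' : (1 : ℝ) ≤ R := by exact_mod_cast hR
  have hex : ∀ k : Fin d → ℤ, ∃ (g : ℕ) (k' u : Fin d → ℤ), k ≠ 0 →
      0 < g ∧ (∀ i, k i = g * k' i) ∧ ∑ i, u i * k' i = 1 := by
    intro k
    by_cases hk : k = 0
    · exact ⟨0, 0, 0, fun h => absurd hk h⟩
    · obtain ⟨g, k', u, h⟩ := exists_primitive hk
      exact ⟨g, k', u, fun _ => h⟩
  choose g k' u h using hex
  set A : ℝ := (2 * R : ℝ) ^ ((d : ℝ) - 1 - β) * ((4 * d + 9) ^ d * (R : ℝ) ^ (d - 1)) with hA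
  have hA0 : 0 ≤ A := by positivity
  have hnorm : ∀ k : Fin d → ℤ, k ≠ 0 → ‖k‖ = g k * ‖k' k‖ := by
    intro k hk
    have : k = (g k : ℤ) • k' k := funext fun i => by simp [(h k hk).2.1 i]
    conv_lhs => rw [this]
    rw [norm_smul]
    simp
  have hk'0 : ∀ k : Fin d → ℤ, k ≠ 0 → k' k ≠ 0 := by
    intro k hk h0
    have := (h k hk).2.2
    simp [h0] at this
  have hterm : ∀ k ∈ (latticeBox d (2 * R)).erase 0, ‖k‖ ^ (-β) *
        (((latticeBox d R).filter fun ξ => ∑ i, ξ i * k i = c k).card : ℝ) ≤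
      A * ((g k : ℝ)⁻¹ * (‖k' k‖ ^ d)⁻¹) := by
    intro k hk
    rw [Finset.mem_erase, mem_latticeBox_iff_norm_le] at hk
    obtain ⟨hk0, hkR⟩ := hk
    obtain ⟨hg, hkg, hu⟩ := h k hk0
    have hg' : (1 : ℝ) ≤ g k := by exact_mod_cast hg
    have hK1 := one_le_norm_of_ne_zero (hk'0 k hk0)
    have hn := hnorm k hk0
    have : Nonempty (Fin d) := ⟨⟨0, by omega⟩⟩
    obtain ⟨i₀, -, hi₀⟩ := Finset.exists_max_image Finset.univ (fun i => |k' k i|)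
      Finset.univ_nonempty
    have hmax : ∀ i, |k' k i| ≤ |k' k i₀| := fun i => hi₀ i (Finset.mem_univ i)
    have hnormK : ‖k' k‖ = ((k' k i₀).natAbs : ℝ) := by
      refine le_antisymm ((pi_norm_le_iff_of_nonneg (Nat.cast_nonneg _)).2 fun i => ?_) ?_
      · rw [Int.norm_eq_abs, Nat.cast_natAbs]
        exact_mod_cast hmax i
      · have := norm_le_pi_norm (k' k) i₀
        rwa [Int.norm_eq_abs, ← Int.cast_abs, ← Nat.cast_natAbs] at this
    have h0 : k' k i₀ ≠ 0 := by
      intro h0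
      rw [hnormK, h0] at hK1
      norm_num at hK1
    have hK2R : ‖k' k‖ ≤ 2 * R := by
      push_cast at hkR
      nlinarith
    have hkR' : |k' k i₀| ≤ 2 * R := by
      rw [hnormK, Nat.cast_natAbs] at hK2R
      exact_mod_cast hK2R
    have hcard := card_hyperplane_mul_le hu hmax h0 hkR' (c k / g k)
    have hsub : ((latticeBox d R).filter fun ξ => ∑ i, ξ i * k i = c k) ⊆
        (latticeBox d R).filter fun ξ => ∑ i, ξ i * k' k i = c k / g k := by
      intro ξ hξ
      rw [Finset.mem_filter] at hξ ⊢
      refine ⟨hξ.1, (Int.ediv_eq_of_eq_mul_right (by exact_mod_cast hg.ne') ?_).symm⟩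
      rw [← hξ.2, Finset.mul_sum]
      refine Finset.sum_congr rfl fun i _ => ?_
      rw [hkg i]; ring
    have hcard' : (((latticeBox d R).filter fun ξ => ∑ i, ξ i * k i = c k).card : ℝ) ≤
        (4 * d + 9) ^ d * (R : ℝ) ^ (d - 1) * ‖k' k‖⁻¹ := by
      have h1 : ((((latticeBox d R).filter fun ξ => ∑ i, ξ i * k i = c k).card : ℝ)) *
          (‖k' k‖ * R) ≤ ((4 * d + 9) * R) ^ d := by
        rw [hnormK]
        exact_mod_cast (Nat.mul_le_mul_right _ (Finset.card_le_card hsub)).trans hcard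
      have h2 : ((4 * d + 9) * (R : ℝ)) ^ d = (4 * d + 9) ^ d * (R : ℝ) ^ (d - 1) * R := by
        rw [mul_pow, mul_assoc, ← pow_succ, Nat.sub_add_cancel (by omega)]
      rw [h2] at h1
      rw [← div_eq_mul_inv, le_div_iff₀ (by linarith)]
      refine le_of_mul_le_mul_right ?_ (show (0 : ℝ) < R by linarith)
      linarith
    have hpow : ‖k‖ ^ (-β) ≤ (2 * R : ℝ) ^ ((d : ℝ) - 1 - β) * (‖k‖ ^ (d - 1))⁻¹ := by
      have hk1 : 0 < ‖k‖ := norm_pos_iff.2 hk0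
      have e : -β = ((d : ℝ) - 1 - β) - ((d - 1 : ℕ) : ℝ) := by
        rw [Nat.cast_sub (by omega)]; push_cast; ring
      rw [e, Real.rpow_sub hk1, Real.rpow_natCast, div_eq_mul_inv]
      gcongr
      exact_mod_cast hkR
    have hgk : (‖k‖ ^ (d - 1))⁻¹ * ‖k' k‖⁻¹ ≤ (g k : ℝ)⁻¹ * (‖k' k‖ ^ d)⁻¹ := by
      rw [← mul_inv, ← mul_inv]
      refine inv_anti₀ (by positivity) ?_
      rw [hn, mul_pow, mul_assoc, ← pow_succ, Nat.sub_add_cancel (by omega)]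
      gcongr
      exact le_self_pow₀ hg' (by omega)
    calc _ ≤ ((2 * R : ℝ) ^ ((d : ℝ) - 1 - β) * (‖k‖ ^ (d - 1))⁻¹) *
          ((4 * d + 9) ^ d * (R : ℝ) ^ (d - 1) * ‖k' k‖⁻¹) := by gcongr
      _ = A * ((‖k‖ ^ (d - 1))⁻¹ * ‖k' k‖⁻¹) := by rw [hA]; ring
      _ ≤ _ := by gcongr
  refine (Finset.sum_le_sum hterm).trans ?_
  rw [← Finset.mul_sum, mul_assoc A]
  refine mul_le_mul_of_nonneg_left ?_ hA0
  have hinj : Set.InjOn (fun k => (g k, k' k))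
      ((latticeBox d (2 * R)).erase 0 : Set (Fin d → ℤ)) := by
    intro k hk l hl heq
    simp only [Prod.mk.injEq] at heq
    have hk0 : k ≠ 0 := (Finset.mem_erase.1 hk).1
    have hl0 : l ≠ 0 := (Finset.mem_erase.1 hl).1
    funext i
    rw [(h k hk0).2.1, (h l hl0).2.1, heq.1, heq.2]
  rw [← Finset.sum_image (f := fun p : ℕ × (Fin d → ℤ) => (p.1 : ℝ)⁻¹ * (‖p.2‖ ^ d)⁻¹) hinj]
  have hsub : ((latticeBox d (2 * R)).erase 0).image (fun k => (g k, k' k)) ⊆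
      Finset.Icc 1 (2 * R) ×ˢ (latticeBox d (2 * R)).erase 0 := by
    intro p hp
    obtain ⟨k, hk, rfl⟩ := Finset.mem_image.1 hp
    rw [Finset.mem_erase, mem_latticeBox_iff_norm_le] at hk
    obtain ⟨hk0, hkR⟩ := hk
    rw [hnorm k hk0] at hkR
    have hg := (h k hk0).1
    have hg' : (1 : ℝ) ≤ g k := by exact_mod_cast hg
    have hK1 := one_le_norm_of_ne_zero (hk'0 k hk0)
    rw [Finset.mem_product, Finset.mem_Icc, Finset.mem_erase, mem_latticeBox_iff_norm_le]
    refine ⟨⟨hg, ?_⟩, hk'0 k hk0, by nlinarith⟩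
    have : (g k : ℝ) ≤ (2 * R : ℕ) := by nlinarith
    exact_mod_cast this
  refine (Finset.sum_le_sum_of_subset_of_nonneg hsub fun p _ _ => by positivity).trans ?_
  rw [Finset.sum_product]
  simp only
  rw [← Finset.sum_mul_sum]
  have e1 := sum_Icc_inv_le (2 * R)
  have e2 := sum_norm_inv_pow_le d (2 * R)
  push_cast at e1 e2
  have hlog : 0 ≤ Real.log (2 * R) := Real.log_nonneg (by linarith)
  calc _ ≤ (1 + Real.log (2 * R)) * (2 * d * 3 ^ (d - 1) * (1 + Real.log (2 * R))) := by
        refine mul_le_mul e1 e2 (Finset.sum_nonneg fun k _ => by positivity) (by linarith)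
    _ = _ := by ring

end Lattice

/-! ### Fourier coefficients of an eigenbasis -/

section Eigenbasis

variable {d : ℕ}

/-- The lattice points of Euclidean length at most `r`, cut out of a box containing them all. -/
noncomputable def latticeBall (d : ℕ) (r : ℝ) : Finset (Fin d → ℤ) :=
  (latticeBox d ⌊r⌋₊).filter fun ξ => ((∑ i, (ξ i) ^ 2 : ℤ) : ℝ) ≤ r ^ 2

lemma mem_latticeBall {r : ℝ} (hr : 0 ≤ r) {ξ : Fin d → ℤ} :
    ξ ∈ latticeBall d r ↔ ((∑ i, (ξ i) ^ 2 : ℤ) : ℝ) ≤ r ^ 2 := by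
  refine ⟨fun h => (Finset.mem_filter.1 h).2, fun h => Finset.mem_filter.2 ⟨?_, h⟩⟩
  have h1 : ‖ξ‖ ≤ r := abs_le_of_sq_le_sq' ((sq_norm_le_sum_sq ξ).trans h) hr |>.2
  rw [mem_latticeBox_iff_norm_le]
  rw [norm_eq_natCast_sup] at h1 ⊢
  exact_mod_cast Nat.le_floor h1

lemma div_pow_le_card_latticeBall (hd : 0 < d) {r : ℝ} (hr : 0 ≤ r) :
    (r / d) ^ d ≤ ((latticeBall d r).card : ℝ) := by
  have hd' : (1 : ℝ) ≤ d := by exact_mod_cast hd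
  have hq : 0 ≤ r / d := by positivity
  have hsub : (Fintype.piFinset fun _ : Fin d => Finset.Icc (0 : ℤ) ⌊r / d⌋₊) ⊆
      latticeBall d r := by
    intro ξ hξ
    rw [Fintype.mem_piFinset] at hξ
    rw [mem_latticeBall hr]
    push_cast
    calc ∑ i, (ξ i : ℝ) ^ 2 ≤ ∑ _i : Fin d, (r / d) ^ 2 := by
          refine Finset.sum_le_sum fun i _ => ?_
          obtain ⟨h0, h1⟩ := Finset.mem_Icc.1 (hξ i)
          have h0' : (0 : ℝ) ≤ ξ i := by exact_mod_cast h0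
          have h1' : (ξ i : ℝ) ≤ (⌊r / d⌋₊ : ℝ) := by exact_mod_cast h1
          have := h1'.trans (Nat.floor_le hq)
          gcongr
      _ = r ^ 2 / d := by
          rw [Finset.sum_const, Finset.card_univ, Fintype.card_fin, nsmul_eq_mul]
          field_simp
      _ ≤ r ^ 2 := div_le_self (by positivity) hd'
  have h := Finset.card_le_card hsub
  rw [Fintype.card_piFinset_const, Int.card_Icc] at h
  calc (r / d) ^ d ≤ ((⌊r / d⌋₊ : ℝ) + 1) ^ d := by
        gcongr
        exact (Nat.lt_floor_add_one _).le
    _ ≤ _ := by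
        have h2 : (⌊r / d⌋₊ + 1) ^ d ≤ (latticeBall d r).card := by
          convert h using 2
          omega
        exact_mod_cast h2

lemma Lp.inner_eq_integral_of_ae_eq {f g : Lp ℂ 2 (torusMeasure d)} {F G : Torus d → ℂ}
    (hf : f =ᵐ[torusMeasure d] F) (hg : g =ᵐ[torusMeasure d] G) :
    inner ℂ f g = ∫ x, conj (F x) * G x ∂torusMeasure d := by
  rw [L2.inner_def]
  refine integral_congr_ae ?_
  filter_upwards [hf, hg] with x h1 h2
  rw [h1, h2, RCLike.inner_apply, mul_comm]

variable {ψ : ℕ → Torus d → ℂ} {ev : ℕ → ℝ}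

namespace IsLaplaceEigenbasis

/-- Parseval's identity for a character in the eigenbasis. -/
lemma hasSum_sq_norm_torusCoeff (h : IsLaplaceEigenbasis ψ ev) (ξ : Fin d → ℤ) :
    HasSum (fun j => ‖torusCoeff (ψ j) ξ‖ ^ 2) 1 := by
  obtain ⟨b, hb⟩ := h.basis
  have hmem : MemLp (torusChar ξ) 2 (torusMeasure d) :=
    MemLp.of_bound (continuous_torusChar ξ).aestronglyMeasurable 1
      (ae_of_all _ fun x => (norm_torusChar ξ x).le)
  have h1 := b.hasSum_inner_mul_inner hmem.toLp hmem.toLp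
  have h2 : inner ℂ (hmem.toLp) (hmem.toLp) = (1 : ℂ) := by
    rw [Lp.inner_eq_integral_of_ae_eq hmem.coeFn_toLp hmem.coeFn_toLp]
    simp [← torusChar_neg, ← torusChar_add, torusChar_zero]
  have h3 : ∀ j, inner ℂ (hmem.toLp) (b j) = torusCoeff (ψ j) ξ := fun j => by
    rw [Lp.inner_eq_integral_of_ae_eq hmem.coeFn_toLp (hb j)]
    simp only [torusCoeff, torusChar_neg]
  rw [h2] at h1
  have h4 : ∀ j, inner ℂ (hmem.toLp) (b j) * inner ℂ (b j) (hmem.toLp) =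
      ((‖torusCoeff (ψ j) ξ‖ ^ 2 : ℝ) : ℂ) := fun j => by
    rw [← inner_conj_symm (b j), h3, Complex.mul_conj, Complex.normSq_eq_norm_sq]
  simp only [h4, ← Complex.ofReal_one] at h1
  exact Complex.hasSum_ofReal.1 h1

lemma torusCoeff_eq_zero (h : IsLaplaceEigenbasis ψ ev) {j : ℕ} {ξ : Fin d → ℤ}
    (hξ : ((∑ i, (ξ i) ^ 2 : ℤ) : ℝ) ≠ ev j ^ 2) : torusCoeff (ψ j) ξ = 0 :=
  (h.eigen j).torusCoeff_eq_zero hξ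

lemma torusCoeff_eq_zero_of_notMem (h : IsLaplaceEigenbasis ψ ev) {j : ℕ} {r : ℝ}
    (hj : ev j ≤ r) {ξ : Fin d → ℤ} (hξ : ξ ∉ latticeBall d r) : torusCoeff (ψ j) ξ = 0 := by
  refine h.torusCoeff_eq_zero fun heq => hξ ?_
  rw [mem_latticeBall ((h.nonneg j).trans hj), heq]
  exact pow_le_pow_left₀ (h.nonneg j) hj 2

/-- An eigenfunction is a trigonometric polynomial. The identity holds at every point, which
matters since it is integrated against measures that may be singular. -/
lemma eq_sum (h : IsLaplaceEigenbasis ψ ev) {j : ℕ} {r : ℝ} (hj : ev j ≤ r) (x : Torus d) :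
    ψ j x = ∑ ξ ∈ latticeBall d r, torusCoeff (ψ j) ξ * torusChar ξ x :=
  ((h.eigen j).1.hasSum x).unique (hasSum_sum_of_ne_finset_zero fun ξ hξ => by
    rw [h.torusCoeff_eq_zero_of_notMem hj hξ, zero_mul])

lemma sum_conj_torusCoeff_mul (h : IsLaplaceEigenbasis ψ ev) {j k : ℕ} {r : ℝ} (hj : ev j ≤ r) :
    ∑ ξ ∈ latticeBall d r, conj (torusCoeff (ψ j) ξ) * torusCoeff (ψ k) ξ =
      if j = k then 1 else 0 := by
  obtain ⟨b, hb⟩ := h.basis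
  have h1 := orthonormal_iff_ite.1 b.orthonormal j k
  rw [← h1, Lp.inner_eq_integral_of_ae_eq (hb j) (hb k)]
  simp only [torusCoeff.eq_1 (ψ k), ← integral_const_mul]
  have hk := (h.eigen k).1.continuous
  rw [← integral_finsetSum _ fun ξ _ => Continuous.integrable_torus
    (f := fun x => conj (torusCoeff (ψ j) ξ) * (torusChar (-ξ) x * ψ k x))
    (continuous_const.mul ((continuous_torusChar _).mul hk)) _]
  refine integral_congr_ae (ae_of_all _ fun x => ?_)
  simp only
  rw [h.eq_sum hj x, map_sum, Finset.sum_mul]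
  refine Finset.sum_congr rfl fun ξ _ => ?_
  rw [map_mul, torusChar_neg]
  ring

lemma sum_sq_norm_torusCoeff (h : IsLaplaceEigenbasis ψ ev) {j : ℕ} {r : ℝ} (hj : ev j ≤ r) :
    ∑ ξ ∈ latticeBall d r, ‖torusCoeff (ψ j) ξ‖ ^ 2 = 1 := by
  have := h.sum_conj_torusCoeff_mul (k := j) hj
  simp only [if_true, mul_comm (conj _), Complex.mul_conj, Complex.normSq_eq_norm_sq] at this
  exact_mod_cast this

lemma finite_setOf_le (h : IsLaplaceEigenbasis ψ ev) (r : ℝ) : {j | ev j ≤ r}.Finite := by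
  by_contra hinf
  obtain ⟨t, ht, hcard⟩ := Set.Infinite.exists_subset_card_eq hinf ((latticeBall d r).card + 1)
  have h1 : (t.card : ℝ) = ∑ j ∈ t, ∑ ξ ∈ latticeBall d r, ‖torusCoeff (ψ j) ξ‖ ^ 2 := by
    rw [Finset.sum_congr rfl fun j hj => h.sum_sq_norm_torusCoeff (ht hj)]
    simp
  have h2 : (t.card : ℝ) ≤ (latticeBall d r).card := by
    rw [h1, Finset.sum_comm, Finset.card_eq_sum_ones, Nat.cast_sum]
    refine Finset.sum_le_sum fun ξ _ => ?_
    rw [Nat.cast_one]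
    exact sum_le_hasSum t (fun j _ => by positivity) (h.hasSum_sq_norm_torusCoeff ξ)
  have h3 : t.card ≤ (latticeBall d r).card := by exact_mod_cast h2
  omega

/-- The counting function of an eigenbasis counts lattice points: evaluate the sum of
`|⟨e_ξ, ψ_j⟩|²` over `ev j ≤ r` and `|ξ| ≤ r` in both orders. -/
lemma spectralCount_eq (h : IsLaplaceEigenbasis ψ ev) {r : ℝ} (hr : 0 ≤ r) :
    spectralCount ev r = (latticeBall d r).card := by
  have hfin := h.finite_setOf_le r
  have hmem : ∀ j, j ∈ hfin.toFinset ↔ ev j ≤ r := fun j => by simp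
  rw [spectralCount, Set.ncard_eq_toFinset_card _ hfin]
  have h1 : (hfin.toFinset.card : ℝ) =
      ∑ j ∈ hfin.toFinset, ∑ ξ ∈ latticeBall d r, ‖torusCoeff (ψ j) ξ‖ ^ 2 := by
    rw [Finset.sum_congr rfl fun j hj => h.sum_sq_norm_torusCoeff ((hmem j).1 hj)]
    simp
  have h2 : ((latticeBall d r).card : ℝ) =
      ∑ ξ ∈ latticeBall d r, ∑ j ∈ hfin.toFinset, ‖torusCoeff (ψ j) ξ‖ ^ 2 := by
    rw [Finset.card_eq_sum_ones, Nat.cast_sum]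
    refine Finset.sum_congr rfl fun ξ hξ => ?_
    rw [Nat.cast_one]
    refine (h.hasSum_sq_norm_torusCoeff ξ).unique (hasSum_sum_of_ne_finset_zero fun j hj => ?_)
    rw [hmem, not_le] at hj
    rw [mem_latticeBall hr] at hξ
    rw [h.torusCoeff_eq_zero (hξ.trans_lt (pow_lt_pow_left₀ hj hr two_ne_zero)).ne]
    simp
  rw [Finset.sum_comm, ← h1] at h2
  exact_mod_cast h2.symm

end IsLaplaceEigenbasis

/-- Bessel's inequality for the rank one matrices attached to an orthonormal family of vectors:
these are orthonormal for the Hilbert–Schmidt inner product. -/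
lemma sum_sq_norm_quadraticForm_le {ι κ : Type*} [DecidableEq κ] (s : Finset ι)
    (J : Finset κ) (c : κ → ι → ℂ)
    (hc : ∀ j ∈ J, ∀ k ∈ J, ∑ ξ ∈ s, conj (c j ξ) * c k ξ = if j = k then 1 else 0)
    (T : ι × ι → ℂ) :
    ∑ j ∈ J, ‖∑ p ∈ s ×ˢ s, c j p.1 * conj (c j p.2) * T p‖ ^ 2 ≤ ∑ p ∈ s ×ˢ s, ‖T p‖ ^ 2 := by
  let v : J → EuclideanSpace ℂ ↥(s ×ˢ s) := fun j =>
    WithLp.toLp 2 fun p => conj (c j p.1.1) * c j p.1.2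
  let T' : EuclideanSpace ℂ ↥(s ×ˢ s) := WithLp.toLp 2 fun p => T p.1
  have hv : Orthonormal ℂ v := by
    rw [orthonormal_iff_ite]
    intro j k
    have h1 : inner ℂ (v j) (v k) = ∑ p ∈ s ×ˢ s,
        (conj (c k p.1) * c j p.1) * (conj (c j p.2) * c k p.2) := by
      rw [PiLp.inner_apply, ← Finset.sum_coe_sort (s ×ˢ s)]
      refine Finset.sum_congr rfl fun p _ => ?_
      simp only [v, RCLike.inner_apply, map_mul, Complex.conj_conj]
      ring
    rw [h1, Finset.sum_product]
    simp only
    rw [← Finset.sum_mul_sum, hc _ k.2 _ j.2, hc _ j.2 _ k.2]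
    by_cases hjk : j = k <;> simp [hjk, eq_comm]
  have hB := hv.sum_inner_products_le T' (s := Finset.univ)
  rw [EuclideanSpace.norm_sq_eq, Finset.sum_coe_sort (s ×ˢ s) fun p => ‖T p‖ ^ 2] at hB
  have hinner : ∀ j : J, inner ℂ (v j) T' =
      ∑ p ∈ s ×ˢ s, c j p.1 * conj (c j p.2) * T p := fun j => by
    rw [PiLp.inner_apply, ← Finset.sum_coe_sort (s ×ˢ s)]
    refine Finset.sum_congr rfl fun p _ => ?_
    simp only [v, T', RCLike.inner_apply, map_mul, Complex.conj_conj]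
    ring
  rw [← Finset.sum_coe_sort]
  simpa only [hinner] using hB

/-- The matrix element `∫ a |ψ|² dμ - ∫ a dμ` of an eigenfunction as a quadratic form in its
Fourier coefficients. The diagonal cancels because `ψ` is normalized, and only pairs of
frequencies of equal length contribute. -/
lemma IsLaplaceEigenbasis.matrixElement_eq (h : IsLaplaceEigenbasis ψ ev) {μ : Measure (Torus d)}
    [IsFiniteMeasure μ] {a : Torus d → ℂ} (ha : Continuous a) {j : ℕ} {r : ℝ} (hj : ev j ≤ r) :
    (∫ x, a x * ((‖ψ j x‖ ^ 2 : ℝ) : ℂ) ∂μ) - ∫ x, a x ∂μ =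
      ∑ p ∈ latticeBall d r ×ˢ latticeBall d r,
        torusCoeff (ψ j) p.1 * conj (torusCoeff (ψ j) p.2) *
          if p.1 ≠ p.2 ∧ ∑ i, (p.1 i) ^ 2 = ∑ i, (p.2 i) ^ 2 then
            ∫ x, torusChar (p.1 - p.2) x * a x ∂μ else 0 := by
  have h1 : ∫ x, a x * ((‖ψ j x‖ ^ 2 : ℝ) : ℂ) ∂μ =
      ∑ p ∈ latticeBall d r ×ˢ latticeBall d r,
        torusCoeff (ψ j) p.1 * conj (torusCoeff (ψ j) p.2) *
          ∫ x, torusChar (p.1 - p.2) x * a x ∂μ := by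
    simp only [← integral_const_mul]
    rw [← integral_finsetSum _ fun p _ => Continuous.integrable_torus
      (f := fun x => torusCoeff (ψ j) p.1 * conj (torusCoeff (ψ j) p.2) *
        (torusChar (p.1 - p.2) x * a x))
      (continuous_const.mul ((continuous_torusChar _).mul ha)) _]
    refine integral_congr_ae (ae_of_all _ fun x => ?_)
    simp only
    rw [← Complex.normSq_eq_norm_sq, ← Complex.mul_conj, h.eq_sum hj x, map_sum,
      Finset.sum_mul_sum, ← Finset.sum_product', Finset.mul_sum]
    refine Finset.sum_congr rfl fun p _ => ?_
    rw [sub_eq_add_neg, torusChar_add, torusChar_neg, map_mul]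
    ring
  have h2 : ∫ x, a x ∂μ = ∑ p ∈ latticeBall d r ×ˢ latticeBall d r,
        torusCoeff (ψ j) p.1 * conj (torusCoeff (ψ j) p.2) *
          if p.1 = p.2 then ∫ x, torusChar (p.1 - p.2) x * a x ∂μ else 0 := by
    rw [Finset.sum_product]
    have h3 := h.sum_conj_torusCoeff_mul (k := j) hj
    rw [if_pos rfl] at h3
    calc ∫ x, a x ∂μ = (∑ ξ ∈ latticeBall d r,
          conj (torusCoeff (ψ j) ξ) * torusCoeff (ψ j) ξ) * ∫ x, a x ∂μ := by rw [h3, one_mul]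
      _ = _ := by
        rw [Finset.sum_mul]
        refine Finset.sum_congr rfl fun ξ hξ => ?_
        rw [Finset.sum_eq_single_of_mem ξ hξ fun η _ hη => by simp [hη.symm]]
        simp [torusChar_zero, mul_comm]
  rw [h1, h2, ← Finset.sum_sub_distrib]
  refine Finset.sum_congr rfl fun p _ => ?_
  rw [← mul_sub]
  by_cases hp : p.1 = p.2
  · simp [hp]
  by_cases hq : ∑ i, (p.1 i) ^ 2 = ∑ i, (p.2 i) ^ 2
  · simp [hp, hq]
  -- the two frequencies cannot both lie on the sphere of radius `ev j`
  have h0 : torusCoeff (ψ j) p.1 * conj (torusCoeff (ψ j) p.2) = 0 := by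
    by_cases he : ((∑ i, (p.1 i) ^ 2 : ℤ) : ℝ) = ev j ^ 2
    · rw [h.torusCoeff_eq_zero (ξ := p.2) fun he' => hq (by exact_mod_cast he.trans he'.symm)]
      simp
    · rw [h.torusCoeff_eq_zero he, zero_mul]
  rw [h0, zero_mul, zero_mul]

/-- Off-diagonal pairs of frequencies of equal length, sorted by their difference `k`: the
equation `|ξ - k| = |ξ|` puts `ξ` on the hyperplane `2 ξ·k = |k|²`. -/
lemma sum_pairs_le (d : ℕ) {r : ℝ} (f : (Fin d → ℤ) → ℝ) (hf : ∀ k, 0 ≤ f k) :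
    ∑ p ∈ (latticeBall d r ×ˢ latticeBall d r).filter
        (fun p => p.1 ≠ p.2 ∧ ∑ i, (p.1 i) ^ 2 = ∑ i, (p.2 i) ^ 2), f (p.1 - p.2) ≤
      ∑ k ∈ (latticeBox d (2 * ⌊r⌋₊)).erase 0, f k *
        (((latticeBox d ⌊r⌋₊).filter fun ξ =>
          ∑ i, ξ i * k i = (∑ i, (k i) ^ 2) / 2).card : ℝ) := by
  rw [← Finset.sum_fiberwise_of_maps_to (g := fun p => p.1 - p.2)
    (t := (latticeBox d (2 * ⌊r⌋₊)).erase 0)]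
  · refine Finset.sum_le_sum fun k _ => ?_
    rw [Finset.sum_congr rfl fun p hp => by rw [(Finset.mem_filter.1 hp).2], Finset.sum_const,
      nsmul_eq_mul, mul_comm]
    refine mul_le_mul_of_nonneg_left ?_ (hf k)
    refine Nat.cast_le.2 (Finset.card_le_card_of_injOn Prod.fst ?_ ?_)
    · rintro ⟨ξ, η⟩ hp
      simp only [Finset.coe_filter, Finset.mem_filter, Finset.mem_product, Set.mem_ofPred_eq] at hp
      obtain ⟨⟨⟨hξ, -⟩, -, heq⟩, rfl⟩ := hp
      refine Finset.mem_coe.2 (Finset.mem_filter.2 ⟨(Finset.mem_filter.1 hξ).1, ?_⟩)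
      have : ∑ i, ((ξ - η) i) ^ 2 = 2 * ∑ i, ξ i * (ξ - η) i := by
        have e : ∑ i, ((ξ - η) i) ^ 2 =
            2 * ∑ i, ξ i * (ξ - η) i - (∑ i, (ξ i) ^ 2 - ∑ i, (η i) ^ 2) := by
          rw [Finset.mul_sum, ← Finset.sum_sub_distrib, ← Finset.sum_sub_distrib]
          refine Finset.sum_congr rfl fun i _ => ?_
          simp only [Pi.sub_apply]
          ring
        rw [e, heq, sub_self, sub_zero]
      rw [this, Int.mul_ediv_cancel_left _ two_ne_zero]
    · rintro ⟨ξ, η⟩ hp ⟨ξ', η'⟩ hp' (rfl : ξ = ξ')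
      simp only [Finset.coe_filter, Set.mem_ofPred_eq] at hp hp'
      have := hp.2.trans hp'.2.symm
      simpa using this
  · rintro ⟨ξ, η⟩ hp
    simp only [Finset.mem_filter, Finset.mem_product, latticeBall, mem_latticeBox] at hp
    obtain ⟨⟨⟨hξ, -⟩, hη, -⟩, hne, -⟩ := hp
    rw [Finset.mem_erase, mem_latticeBox]
    refine ⟨sub_ne_zero.2 hne, fun i => (abs_sub _ _).trans ?_⟩
    have h1 := hξ i
    have h2 := hη i
    push_cast
    linarith

end Eigenbasis

/-! ### Fourier decay of a measure with a smooth density -/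

section Decay

variable {d : ℕ}

/-- Multiplying a measure by a smooth function preserves a power decay rate of its Fourier
coefficients: the coefficients are convolved with a rapidly decaying sequence. -/
lemma exists_norm_integral_torusChar_mul_le {μ : Measure (Torus d)} [IsFiniteMeasure μ]
    {D γ : ℝ} (hγ0 : 0 ≤ γ) (hγd : γ ≤ d)
    (hμ : ∀ n, ‖measureFourierCoeff μ n‖ ≤ D * (1 + ‖n‖) ^ (-γ))
    {a : Torus d → ℂ} (ha : SmoothOnTorus a) :
    ∃ A : ℝ, 0 < A ∧ ∀ k, k ≠ 0 → ‖∫ x, torusChar k x * a x ∂μ‖ ≤ A * ‖k‖ ^ (-γ) := by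
  have hD : 0 ≤ D := by
    have := (norm_nonneg _).trans (hμ 0)
    simpa using this
  have hS := ha.summable_torusCoeff_mul_pow d
  set S := ∑' m, ‖torusCoeff a m‖ * (1 + ‖m‖) ^ d
  have hS0 : 0 ≤ S := tsum_nonneg fun m => by positivity
  refine ⟨D * S + 1, by positivity, fun k hk => ?_⟩
  have hk1 : 0 < ‖k‖ := norm_pos_iff.2 hk
  have hsum0 : Summable fun m => ‖torusCoeff a m‖ := by
    simpa using ha.summable_torusCoeff_mul_pow 0
  let F : (Fin d → ℤ) → Torus d → ℂ := fun m x => torusCoeff a m * torusChar (m + k) x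
  have hnF : ∀ m x, ‖F m x‖ = ‖torusCoeff a m‖ := fun m x => by
    simp only [F]; rw [norm_mul, norm_torusChar, mul_one]
  have hF := hasSum_integral_of_summable_integral_norm (μ := μ) (F := F)
    (fun m => (continuous_const.mul (continuous_torusChar _)).integrable_torus μ)
    (by simpa only [hnF, integral_const, smul_eq_mul] using hsum0.mul_left _)
  have hFsum : ∀ x, ∑' m, F m x = torusChar k x * a x := fun x => by
    refine HasSum.tsum_eq ?_
    have := (ha.hasSum x).mul_left (torusChar k x)
    refine this.congr_fun fun m => ?_
    simp only [F, torusChar_add]; ring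
  have hFint : ∀ m, ∫ x, F m x ∂μ = torusCoeff a m * measureFourierCoeff μ (-(m + k)) := fun m => by
    simp only [F, integral_const_mul, measureFourierCoeff, neg_neg]
  simp only [hFsum, hFint] at hF
  have hbound : ∀ m, ‖torusCoeff a m * measureFourierCoeff μ (-(m + k))‖ ≤
      D * ‖k‖ ^ (-γ) * (‖torusCoeff a m‖ * (1 + ‖m‖) ^ d) := by
    intro m
    have hpeetre : ‖k‖ ≤ (1 + ‖m‖) * (1 + ‖m + k‖) := by
      have : ‖k‖ ≤ ‖m + k‖ + ‖m‖ := by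
        calc ‖k‖ = ‖(m + k) - m‖ := by rw [add_sub_cancel_left]
          _ ≤ _ := norm_sub_le _ _
      nlinarith [norm_nonneg m, norm_nonneg (m + k)]
    have h1 : (1 + ‖m + k‖) ^ (-γ) ≤ ‖k‖ ^ (-γ) * (1 + ‖m‖) ^ d := by
      have h2 : ((1 + ‖m‖) * (1 + ‖m + k‖)) ^ (-γ) ≤ ‖k‖ ^ (-γ) :=
        Real.rpow_le_rpow_of_nonpos hk1 hpeetre (by linarith)
      rw [Real.mul_rpow (by positivity) (by positivity)] at h2
      have h3 : (1 + ‖m‖) ^ γ ≤ (1 + ‖m‖) ^ d := by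
        rw [← Real.rpow_natCast]
        exact Real.rpow_le_rpow_of_exponent_le (by linarith [norm_nonneg m]) hγd
      have h4 : (1 + ‖m‖) ^ (-γ) * (1 + ‖m‖) ^ γ = 1 := by
        rw [← Real.rpow_add (by positivity), neg_add_cancel, Real.rpow_zero]
      calc (1 + ‖m + k‖) ^ (-γ)
          = ((1 + ‖m‖) ^ (-γ) * (1 + ‖m + k‖) ^ (-γ)) * (1 + ‖m‖) ^ γ := by
            linear_combination (-(1 + ‖m + k‖) ^ (-γ)) * h4
        _ ≤ _ := by gcongr
    rw [norm_mul]
    have h5 := hμ (-(m + k))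
    rw [norm_neg] at h5
    calc _ ≤ ‖torusCoeff a m‖ * (D * (‖k‖ ^ (-γ) * (1 + ‖m‖) ^ d)) := by
          gcongr
          exact h5.trans (by gcongr)
      _ = _ := by ring
  have hle := tsum_of_norm_bounded (hS.hasSum.mul_left (D * ‖k‖ ^ (-γ))) hbound
  rw [hF.tsum_eq] at hle
  refine hle.trans ?_
  have : 0 ≤ ‖k‖ ^ (-γ) := by positivity
  nlinarith

lemma norm_le_latticeNorm (n : Fin d → ℤ) : ‖n‖ ≤ latticeNorm n := by
  refine Real.le_sqrt_of_sq_le ?_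
  have := sq_norm_le_sum_sq n
  push_cast at this
  exact this

/-- The decay hypothesis, weakened to an exponent `β ≤ α` and put into a form that includes the
zero frequency. -/
lemma exists_norm_measureFourierCoeff_le {μ : Measure (Torus d)} [IsProbabilityMeasure μ]
    {α β C : ℝ} (hC : 0 < C) (hβ0 : 0 ≤ β) (hβα : β ≤ α)
    (hμ : ∀ n : Fin d → ℤ, n ≠ 0 →
      ‖measureFourierCoeff μ n‖ ^ 2 ≤ C * latticeNorm n ^ (-α)) :
    ∃ D, ∀ n, ‖measureFourierCoeff μ n‖ ≤ D * (1 + ‖n‖) ^ (-(β / 2)) := by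
  refine ⟨Real.sqrt (C * 2 ^ β + 1), fun n => ?_⟩
  have hsq : (1 + ‖n‖) ^ (-(β / 2)) = Real.sqrt ((1 + ‖n‖) ^ (-β)) := by
    rw [Real.sqrt_eq_rpow, ← Real.rpow_mul (by positivity)]
    congr 1; ring
  rw [hsq, ← Real.sqrt_mul (by positivity)]
  refine Real.le_sqrt_of_sq_le ?_
  rcases eq_or_ne n 0 with rfl | hn
  · have h1 : measureFourierCoeff μ (0 : Fin d → ℤ) = 1 := by
      simp [measureFourierCoeff, torusChar_zero]
    have : 0 ≤ C * (2 : ℝ) ^ β := by positivity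
    simp [h1, this]
  · have hn1 := one_le_norm_of_ne_zero hn
    have h1 : latticeNorm n ^ (-α) ≤ ‖n‖ ^ (-β) :=
      (Real.rpow_le_rpow_of_nonpos (by linarith) (norm_le_latticeNorm n) (by linarith)).trans
        (Real.rpow_le_rpow_of_exponent_le hn1 (by linarith))
    have h2 : ‖n‖ ^ (-β) ≤ 2 ^ β * (1 + ‖n‖) ^ (-β) := by
      have h3 : ‖n‖ ^ (-β) ≤ ((1 + ‖n‖) / 2) ^ (-β) :=
        Real.rpow_le_rpow_of_nonpos (by positivity) (by linarith) (by linarith)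
      rw [Real.div_rpow (by positivity) (by positivity), Real.rpow_neg zero_le_two,
        div_inv_eq_mul, mul_comm] at h3
      exact h3
    have h4 : 0 ≤ (1 + ‖n‖) ^ (-β) := by positivity
    calc _ ≤ C * latticeNorm n ^ (-α) := hμ n hn
      _ ≤ C * (2 ^ β * (1 + ‖n‖) ^ (-β)) := by gcongr; exact h1.trans h2
      _ ≤ _ := by linarith

end Decay

/-! ### Variance of the matrix elements -/

theorem theorem2p6 (d : ℕ) (hd : 2 ≤ d) (μ : Measure (Torus d)) [IsProbabilityMeasure μ]
    (α C : ℝ) (hα : 0 ≤ α) (hC : 0 < C)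
    (hμ : ∀ n : Fin d → ℤ, n ≠ 0 →
      ‖measureFourierCoeff μ n‖ ^ 2 ≤ C * latticeNorm n ^ (-α))
    (a : Torus d → ℂ) (ha : SmoothOnTorus a) :
    ∃ Ca : ℝ, 0 < Ca ∧
      ∀ (ψ : ℕ → Torus d → ℂ) (ev : ℕ → ℝ), IsLaplaceEigenbasis ψ ev →
        ∀ lam : ℝ, 2 ≤ lam →
          {j | ev j ≤ lam}.Finite ∧
          (1 / (spectralCount ev lam : ℝ)) *
              ∑ᶠ j ∈ {j | ev j ≤ lam},
                ‖(∫ x, a x * ((‖ψ j x‖ ^ 2 : ℝ) : ℂ) ∂μ) - ∫ x, a x ∂μ‖ ^ 2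
            ≤ Ca * (Real.log lam) ^ 2 * lam ^ (max ((d : ℝ) - 2 - α) (-1)) := by
  have hd' : (2 : ℝ) ≤ d := by exact_mod_cast hd
  -- beyond the exponent `d - 1`, faster decay of the coefficients does not improve the bound
  obtain ⟨β, hβ⟩ : ∃ β, β = min α ((d : ℝ) - 1) := ⟨_, rfl⟩
  have hβ0 : 0 ≤ β := hβ ▸ le_min hα (by linarith)
  have hβα : β ≤ α := hβ ▸ min_le_left _ _
  have hβd : β ≤ d - 1 := hβ ▸ min_le_right _ _
  have hexp : max ((d : ℝ) - 2 - α) (-1) = d - 2 - β := by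
    rw [hβ]
    rcases le_total α ((d : ℝ) - 1) with h | h
    · rw [min_eq_left h, max_eq_left (by linarith)]
    · rw [min_eq_right h, max_eq_right (by linarith)]; ring
  rw [hexp]
  obtain ⟨D, hD⟩ := exists_norm_measureFourierCoeff_le hC hβ0 hβα hμ
  obtain ⟨A, hA0, hA⟩ := exists_norm_integral_torusChar_mul_le (by linarith)
    (by linarith) hD ha
  refine ⟨A ^ 2 * (2 ^ ((d : ℝ) - 1 - β) * (4 * d + 9) ^ d * (2 * d * 3 ^ (d - 1)) * 16 *
    (d : ℝ) ^ d), by positivity, fun ψ ev h lam hlam => ⟨h.finite_setOf_le lam, ?_⟩⟩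
  have hlam0 : 0 ≤ lam := by linarith
  have hfin := h.finite_setOf_le lam
  have hmem : ∀ j, j ∈ hfin.toFinset ↔ ev j ≤ lam := fun j => by simp
  rw [finsum_mem_eq_finite_toFinset_sum _ hfin, h.spectralCount_eq hlam0]
  set R := ⌊lam⌋₊ with hR
  have hR1 : 1 ≤ R := Nat.le_floor (by norm_num; linarith)
  have hRlam : (R : ℝ) ≤ lam := Nat.floor_le hlam0
  have hR1' : (1 : ℝ) ≤ R := by exact_mod_cast hR1
  set ν : (Fin d → ℤ) → ℂ := fun k => ∫ x, torusChar k x * a x ∂μ with hν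
  have hν2 : ∀ k, k ≠ 0 → ‖ν k‖ ^ 2 ≤ A ^ 2 * ‖k‖ ^ (-β) := by
    intro k hk
    have h1 : ‖k‖ ^ (-β) = (‖k‖ ^ (-(β / 2))) ^ 2 := by
      rw [← Real.rpow_mul_natCast (norm_nonneg k)]
      congr 1; push_cast; ring
    rw [h1, ← mul_pow]
    exact pow_le_pow_left₀ (norm_nonneg _) (hA k hk) 2
  have hsum : ∑ j ∈ hfin.toFinset,
      ‖(∫ x, a x * ((‖ψ j x‖ ^ 2 : ℝ) : ℂ) ∂μ) - ∫ x, a x ∂μ‖ ^ 2 ≤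
      A ^ 2 * ((2 * R : ℝ) ^ ((d : ℝ) - 1 - β) * ((4 * d + 9) ^ d * (R : ℝ) ^ (d - 1)) *
        (2 * d * 3 ^ (d - 1)) * (1 + Real.log (2 * R)) ^ 2) := by
    rw [Finset.sum_congr rfl fun j hj => by
      rw [h.matrixElement_eq (μ := μ) ha.continuous ((hmem j).1 hj)]]
    refine (sum_sq_norm_quadraticForm_le (latticeBall d lam) hfin.toFinset
      (fun j => torusCoeff (ψ j))
      (fun j hj k _ => h.sum_conj_torusCoeff_mul ((hmem j).1 hj)) _).trans ?_
    have e1 : ∑ p ∈ latticeBall d lam ×ˢ latticeBall d lam,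
        ‖if p.1 ≠ p.2 ∧ ∑ i, (p.1 i) ^ 2 = ∑ i, (p.2 i) ^ 2 then ν (p.1 - p.2) else 0‖ ^ 2 =
        ∑ p ∈ (latticeBall d lam ×ˢ latticeBall d lam).filter
          (fun p => p.1 ≠ p.2 ∧ ∑ i, (p.1 i) ^ 2 = ∑ i, (p.2 i) ^ 2), ‖ν (p.1 - p.2)‖ ^ 2 := by
      rw [Finset.sum_filter]
      refine Finset.sum_congr rfl fun p _ => ?_
      split_ifs <;> simp
    refine e1.trans_le ((sum_pairs_le d (fun k => ‖ν k‖ ^ 2) fun k => by positivity).trans ?_)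
    refine le_trans ?_ (mul_le_mul_of_nonneg_left (sum_rpow_mul_card_hyperplane_le hd hR1 hβd
      fun k => (∑ i, (k i) ^ 2) / 2) (sq_nonneg A))
    rw [Finset.mul_sum]
    refine Finset.sum_le_sum fun k hk => ?_
    rw [← mul_assoc]
    exact mul_le_mul_of_nonneg_right (hν2 k (Finset.mem_erase.1 hk).1) (Nat.cast_nonneg _)
  have hN := div_pow_le_card_latticeBall (d := d) (by omega) hlam0
  have hlog : 1 + Real.log (2 * R) ≤ 4 * Real.log lam := by
    have h1 : Real.log (2 * R) ≤ Real.log (2 * lam) :=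
      Real.log_le_log (by linarith) (by linarith)
    rw [Real.log_mul two_ne_zero (y := lam) (by linarith)] at h1
    have h2 : Real.log 2 ≤ Real.log lam := Real.log_le_log two_pos hlam
    linarith [Real.log_two_gt_d9]
  have hlog0 : 0 ≤ 1 + Real.log (2 * R) := by
    linarith [Real.log_nonneg (show (1 : ℝ) ≤ 2 * R by linarith)]
  have hpos : (0 : ℝ) < (lam / d) ^ d := by positivity
  have hpow : lam ^ ((d : ℝ) - 2 - β) = lam ^ ((d : ℝ) - 1 - β) * lam ^ (d - 1) / lam ^ d := by
    rw [← Real.rpow_natCast, ← Real.rpow_natCast, ← Real.rpow_add (by linarith),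
      ← Real.rpow_sub (by linarith), Nat.cast_sub (by omega)]
    congr 1; push_cast; ring
  calc _ ≤ 1 / (lam / d) ^ d *
        (A ^ 2 * ((2 * lam : ℝ) ^ ((d : ℝ) - 1 - β) * ((4 * d + 9) ^ d * lam ^ (d - 1)) *
          (2 * d * 3 ^ (d - 1)) * (4 * Real.log lam) ^ 2)) := by
        refine mul_le_mul (one_div_le_one_div_of_le hpos hN) (hsum.trans ?_)
          (Finset.sum_nonneg fun j _ => by positivity) (by positivity)
        have : 0 ≤ (d : ℝ) - 1 - β := by linarith
        gcongr
    _ = _ := by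
        rw [hpow, Real.mul_rpow zero_le_two hlam0, div_pow]
        field_simp
        ring
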